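/- Let $k$ be an algebraically closed field, let $G$ be an abelian group with neutral element $e$, let $n$ be a natural number, and let $A=M_n(k)$ be the algebra of $n\times n$ matrices over $k$. Let $A=\bigoplus_{g\in G}A_g$ be any $G$-grading of $A$, i.e. a decomposition of $A$ into a direct sum of $k$-subspaces with $A_gA_h\subseteq A_{gh}$ for all $g,h\in G$. Then $A$ with this grading is a graded symmetric algebra. Here the dual space $A^*=\mathrm{Hom}_k(A,k)$ is regarded as an $A$-bimodule via $(a\cdot f)(x)=f(xa)$ and $(f\cdot a)(x)=f(ax)$ for $a,x\in A$, $f\in A^*$, and is graded by $(A^*)_g=\{f\in A^* \mid f(A_h)=0 \text{ for all } h\neq g^{-1}\}$. A finite dimensional $G$-graded algebra $A$ is called graded symmetric if $A$ and $A^*$ are isomorphic as graded $A$-bimodules, i.e. if there is a $k$-linear bijection $\varphi:A\to A^*$ with $\varphi(ax)=a\cdot\varphi(x)$, $\varphi(xa)=\varphi(x)\cdot a$ for all $a,x\in A$ and $\varphi(A_g)=(A^*)_g$ for all $g\in G$. -/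

import Mathlib

namespace GradedSymm

variable {k A G : Type*} [Field k] [Ring A] [Algebra k A]

/-- The left action of `A` on its linear dual `A*`: `(a · f)(x) = f (x * a)`. -/
def dualLeft (a : A) (f : Module.Dual k A) : Module.Dual k A :=
  f ∘ₗ LinearMap.mulRight k a

/-- The right action of `A` on its linear dual `A*`: `(f · a)(x) = f (a * x)`. -/
def dualRight (f : Module.Dual k A) (a : A) : Module.Dual k A :=
  f ∘ₗ LinearMap.mulLeft k a

@[simp]
theorem dualLeft_apply (a : A) (f : Module.Dual k A) (x : A) :
    dualLeft a f x = f (x * a) := rfl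

@[simp]
theorem dualRight_apply (f : Module.Dual k A) (a : A) (x : A) :
    dualRight f a x = f (a * x) := rfl

/-- The degree `g` component of the dual of a graded algebra (grading group written additively):
the functionals that vanish on every component of degree `h ≠ -g`. -/
def dualGrading [AddGroup G] (𝒜 : G → Submodule k A) (g : G) : Submodule k (Module.Dual k A) where
  carrier := {f | ∀ h : G, h ≠ -g → ∀ x ∈ 𝒜 h, f x = 0}
  zero_mem' := fun _ _ _ _ => rfl
  add_mem' := by
    intro f f' hf hf' h hh x hx
    simp [hf h hh x hx, hf' h hh x hx]
  smul_mem' := by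
    intro c f hf h hh x hx
    simp [hf h hh x hx]

/-- A finite dimensional `G`-graded algebra is graded symmetric if `A` and `A*` are isomorphic as
graded left `A`, right `A` bimodules. -/
def IsGradedSymmetric [AddGroup G] (𝒜 : G → Submodule k A) : Prop :=
  FiniteDimensional k A ∧
  ∃ φ : A ≃ₗ[k] Module.Dual k A,
    (∀ a x : A, φ (a * x) = dualLeft a (φ x)) ∧
    (∀ x a : A, φ (x * a) = dualRight (φ x) a) ∧
    ∀ g : G, (𝒜 g).map φ.toLinearMap = dualGrading 𝒜 g

end GradedSymm

namespace GradedSymm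

open Matrix Polynomial

/-! ### Idempotent matrices over a commutative ring -/

section IdempotentMatrix

variable {m R S : Type*} [Fintype m] [DecidableEq m] [CommRing R] [CommRing S]

/-! The graded isomorphism is the trace form `x ↦ (y ↦ tr (x y))`; everything rests on the trace
vanishing in nonzero degrees (`trace_eq_zero_of_mem`). The grading gives an algebra map `x ↦ x ⊗ g`
into matrices over the group algebra, commutative since `G` is. Such a map preserves traces
(`trace_map_algHom`), so `tr x · g = tr x · 1`. Trace preservation reduces to `tr (ρ E_ii) = 1`. The
target ring is arbitrary, so rank is replaced by the polynomial `rankPoly`, which yields the trace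
in every characteristic. -/

theorem det_one_add_smul_mul_of_isIdempotentElem {e : Matrix m m S} (he : IsIdempotentElem e)
    (s t : S) :
    (1 + (s - 1) • e).det * (1 + (t - 1) • e).det = (1 + (s * t - 1) • e).det := by
  rw [← det_mul]
  congr 1
  simp only [mul_add, add_mul, one_mul, mul_one, smul_mul_assoc, mul_smul_comm, he.eq]
  module

/-- The polynomial `det (1 - e + X e)`; for an idempotent `e` over a field it equals
`X ^ rank e`. -/
noncomputable def rankPoly (e : Matrix m m R) : R[X] :=
  (1 + (X - 1 : R[X]) • e.map C).det

theorem map_rankPoly (f : R[X] →+* S) (e : Matrix m m R) :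
    f (rankPoly e) = (1 + (f X - 1) • e.map (f.comp C)).det := by
  rw [rankPoly, RingHom.map_det]
  congr 1
  ext i j
  by_cases h : i = j <;> simp [h]

theorem eval_one_rankPoly (e : Matrix m m R) : (rankPoly e).eval 1 = 1 := by
  have := map_rankPoly (evalRingHom 1) e
  simpa using this

/-- Shifting `X` to `X + 1` turns `rankPoly e` into `det (1 + X e)`, whose derivative at `0` is the
trace. -/
theorem trace_eq_one_of_rankPoly_eq_X {e : Matrix m m R} (h : rankPoly e = X) : e.trace = 1 := by
  have hQ : (1 + (X : R[X]) • e.map C).det = X + 1 := by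
    have := map_rankPoly (compRingHom (X + 1)) e
    rw [h] at this
    simp only [coe_compRingHom_apply, X_comp, add_sub_cancel_right] at this
    rw [this]
    congr 3
    ext i j
    simp
  rw [← derivative_det_one_add_X_smul, hQ]
  simp

/-- Writing `P` for `rankPoly e`, compare coefficients of `Y ^ i` in `P(X) P(Y) = P(XY)`. -/
theorem rankPoly_mul_C_coeff {e : Matrix m m R} (he : IsIdempotentElem e) (i : ℕ) :
    rankPoly e * C ((rankPoly e).coeff i) = C ((rankPoly e).coeff i) * X ^ i := by
  have he' : IsIdempotentElem (e.map ((C : R[X] →+* R[X][X]).comp C)) := by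
    have := congrArg (RingHom.mapMatrix ((C : R[X] →+* R[X][X]).comp C)) he.eq
    rwa [map_mul] at this
  have hC := map_rankPoly (C : R[X] →+* R[X][X]) e
  have hY := map_rankPoly (mapRingHom (C : R →+* R[X])) e
  have hXY := map_rankPoly ((compRingHom (C X * X)).comp (mapRingHom (C : R →+* R[X]))) e
  have h1 : (mapRingHom (C : R →+* R[X])).comp C = (C : R[X] →+* R[X][X]).comp C := by
    ext; simp
  have h2 : ((compRingHom (C X * X)).comp (mapRingHom (C : R →+* R[X]))).comp C =
      (C : R[X] →+* R[X][X]).comp C := by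
    ext; simp
  rw [h1] at hY
  rw [h2] at hXY
  -- In `R[X][X]`, `C X` plays the role of `X` and the outer variable that of `Y`.
  have key := det_one_add_smul_mul_of_isIdempotentElem he' (C X) X
  simp only [coe_mapRingHom, map_X] at hY
  simp only [RingHom.comp_apply, coe_mapRingHom, map_X, coe_compRingHom_apply, X_comp] at hXY
  rw [← hC, ← hY, ← hXY] at key
  have := congrArg (fun p => p.coeff i) key
  simpa [comp_C_mul_X_coeff] using this

/-- Each coefficient `c_i` satisfies `c_i X ^ n = c_i X ^ (i n)`, so only `c_1` survives; evaluating
at `1` gives `c_1 = 1`. -/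
theorem rankPoly_eq_X_of_pow_eq {e : Matrix m m R} (he : IsIdempotentElem e) {n : ℕ} (hn : n ≠ 0)
    (h : rankPoly e ^ n = X ^ n) : rankPoly e = X := by
  have hpow (i : ℕ) : C ((rankPoly e).coeff i) * X ^ n = C ((rankPoly e).coeff i) * X ^ (i * n) := by
    rw [← h]
    clear h hn
    induction n with
    | zero => simp
    | succ n ih =>
      rw [pow_succ, ← mul_assoc, ih, mul_right_comm, mul_comm (C _) (rankPoly e),
        rankPoly_mul_C_coeff he, mul_assoc, ← pow_add]
      congr 2
      ring
  have hcoeff (i : ℕ) (hi : i ≠ 1) : (rankPoly e).coeff i = 0 := by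
    have := congrArg (fun p => p.coeff n) (hpow i)
    have hne : n ≠ i * n := fun hh => hi (by
      have : 1 * n = i * n := by simpa using hh
      exact (Nat.eq_of_mul_eq_mul_right (Nat.pos_of_ne_zero hn) this).symm)
    simpa [coeff_X_pow, hne] using this
  have hC : rankPoly e = C ((rankPoly e).coeff 1) * X := by
    ext i
    by_cases hi : i = 1
    · subst hi; simp
    · rw [hcoeff i hi, coeff_C_mul, coeff_X, if_neg (Ne.symm hi), mul_zero]
  have h1 := eval_one_rankPoly e
  rw [hC] at h1 ⊢
  simp only [eval_mul, eval_C, eval_X, mul_one] at h1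
  rw [h1, C_1, one_mul]

theorem rankPoly_mul_comm (a b : Matrix m m R) : rankPoly (a * b) = rankPoly (b * a) := by
  simp only [rankPoly, Matrix.map_mul]
  rw [← smul_mul_assoc, det_one_add_mul_comm, mul_smul_comm]

theorem rankPoly_add_of_mul_eq_zero {a b : Matrix m m R} (h : a * b = 0) :
    rankPoly (a + b) = rankPoly a * rankPoly b := by
  have h' : a.map (C : R → R[X]) * b.map C = 0 := by
    rw [← Matrix.map_mul, h]; ext; simp
  rw [rankPoly, rankPoly, rankPoly, ← det_mul]
  congr 1
  simp only [mul_add, add_mul, one_mul, mul_one, smul_mul_assoc, mul_smul_comm, h', smul_zero,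
    Matrix.map_add _ (fun x y => C_add (a := x) (b := y)), smul_add]
  abel

theorem rankPoly_sum_of_pairwise_mul_eq_zero {ι : Type*} (e : ι → Matrix m m R)
    (h : Pairwise fun i j => e i * e j = 0) (s : Finset ι) :
    rankPoly (∑ i ∈ s, e i) = ∏ i ∈ s, rankPoly (e i) := by
  classical
  induction s using Finset.induction_on with
  | empty => simp [rankPoly, Matrix.map_zero]
  | insert a s ha ih =>
    rw [Finset.sum_insert ha, Finset.prod_insert ha, rankPoly_add_of_mul_eq_zero, ih]
    rw [Finset.mul_sum]
    exact Finset.sum_eq_zero fun i hi => h (fun hai => ha (hai ▸ hi))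

theorem rankPoly_one : rankPoly (1 : Matrix m m R) = X ^ Fintype.card m := by
  have : (1 : Matrix m m R[X]) + (X - 1 : R[X]) • (1 : Matrix m m R).map C = (X : R[X]) • 1 := by
    rw [Matrix.map_one _ C_0 C_1]
    module
  rw [rankPoly, this, det_smul, det_one, mul_one]

end IdempotentMatrix

/-! ### Trace preservation -/

section TraceAlgHom

variable {m k R : Type*} [Fintype m] [DecidableEq m] [CommRing k] [CommRing R] [Algebra k R]

/-- The `ρ E_jj` are orthogonal idempotents with sum `1`. They share one `rankPoly`, because `E_jj =
E_ji E_ij` and `E_ii = E_ij E_ji`; its `n`-th power is therefore `X ^ n`. -/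
theorem trace_map_single_self (ρ : Matrix m m k →ₐ[k] Matrix m m R) (i : m) :
    (ρ (single i i 1)).trace = 1 := by
  have hidem (j : m) : IsIdempotentElem (ρ (single j j 1)) := by
    rw [IsIdempotentElem, ← map_mul, single_mul_single_same, one_mul]
  have hperp : Pairwise fun j l => ρ (single j j 1) * ρ (single l l 1) = 0 := fun j l hjl => by
    change _ * _ = _
    rw [← map_mul, single_mul_single_of_ne _ _ _ _ hjl, map_zero]
  have hconj (j : m) : rankPoly (ρ (single j j 1)) = rankPoly (ρ (single i i 1)) := by
    have h := rankPoly_mul_comm (ρ (single j i 1)) (ρ (single i j 1))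
    rwa [← map_mul, ← map_mul, single_mul_single_same, single_mul_single_same, one_mul] at h
  have hsum := rankPoly_sum_of_pairwise_mul_eq_zero _ hperp Finset.univ
  have hone : ∑ j : m, single j j (1 : k) = 1 := by
    ext a b
    simp [Matrix.sum_apply, single_apply, one_apply, ite_and]
  rw [← map_sum, hone, map_one, rankPoly_one, Finset.prod_congr rfl fun j _ => hconj j,
    Finset.prod_const, Finset.card_univ] at hsum
  have : Nonempty m := ⟨i⟩
  exact trace_eq_one_of_rankPoly_eq_X
    (rankPoly_eq_X_of_pow_eq (hidem i) Fintype.card_ne_zero hsum.symm)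

/-- Algebra homomorphisms between matrix algebras of the same size preserve the trace. -/
theorem trace_map_algHom (ρ : Matrix m m k →ₐ[k] Matrix m m R) (x : Matrix m m k) :
    (ρ x).trace = algebraMap k R x.trace := by
  have h : traceLinearMap m k R ∘ₗ ρ.toLinearMap =
      Algebra.linearMap k R ∘ₗ traceLinearMap m k k := by
    refine Matrix.ext_linearMap k fun i j => LinearMap.ext_ring ?_
    by_cases hij : i = j
    · subst hij
      simp [trace_map_single_self]
    · have h0 : (ρ (single i j 1)).trace = 0 := by
        have h1 : single i j (1 : k) = single i i 1 * single i j 1 := by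
          rw [single_mul_single_same, one_mul]
        rw [h1, map_mul, trace_mul_comm, ← map_mul, single_mul_single_of_ne _ _ _ _ (Ne.symm hij),
          map_zero, trace_zero]
      simp [h0, trace_single_eq_of_ne i j _ hij]
  exact LinearMap.congr_fun h x

end TraceAlgHom

/-! ### Gradings and the trace form -/

section Graded

variable {m k G : Type*} [Fintype m] [DecidableEq m] [Field k] [AddCommGroup G] [DecidableEq G]
variable (𝒜 : G → Submodule k (Matrix m m k)) [GradedAlgebra 𝒜]

/-- The coaction `x ↦ x ⊗ g`, for `x` homogeneous of degree `g`, of a group grading on a matrix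
algebra. -/
noncomputable def coaction : Matrix m m k →ₐ[k] Matrix m m (AddMonoidAlgebra k G) :=
  (DirectSum.toAlgebra k (fun g => 𝒜 g)
    (fun g => (AddMonoidAlgebra.lsingle g : k →ₗ[k] AddMonoidAlgebra k G).mapMatrix ∘ₗ
      (𝒜 g).subtype)
    (by
      ext i j : 1
      simp only [SetLike.coe_gOne, LinearMap.comp_apply, Submodule.subtype_apply,
        LinearMap.mapMatrix_apply, Matrix.map_apply]
      by_cases h : i = j <;> simp [h, Matrix.one_apply, AddMonoidAlgebra.one_def])
    (by
      intro g h a b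
      ext i j : 1
      simp [SetLike.coe_gMul, Matrix.mul_apply, AddMonoidAlgebra.single_mul_single])).comp
    (DirectSum.decomposeAlgEquiv 𝒜).toAlgHom

theorem coaction_of_mem {g : G} {x : Matrix m m k} (hx : x ∈ 𝒜 g) :
    coaction 𝒜 x = x.map (AddMonoidAlgebra.single g) := by
  lift x to 𝒜 g using hx
  simp only [coaction, AlgHom.comp_apply]
  change DirectSum.toAlgebra _ _ _ _ _ (DirectSum.decompose 𝒜 (x : Matrix m m k)) = _
  rw [DirectSum.decompose_coe]
  exact DirectSum.toAddMonoid_of (fun i => ((AddMonoidAlgebra.lsingle i :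
    k →ₗ[k] AddMonoidAlgebra k G).mapMatrix ∘ₗ (𝒜 i).subtype).toAddMonoidHom) g x

theorem trace_eq_zero_of_mem {g : G} (hg : g ≠ 0) {x : Matrix m m k} (hx : x ∈ 𝒜 g) :
    x.trace = 0 := by
  have h := trace_map_algHom (coaction 𝒜) x
  rw [coaction_of_mem 𝒜 hx] at h
  have h' : (x.map (AddMonoidAlgebra.single g)).trace = AddMonoidAlgebra.single g x.trace := by
    exact (map_sum (AddMonoidAlgebra.lsingle g : k →ₗ[k] AddMonoidAlgebra k G) _ _).symm
  rw [h'] at h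
  have := congrArg (fun p : AddMonoidAlgebra k G => p.coeff g) h
  simpa [Finsupp.single_apply, hg.symm] using this

theorem trace_decompose_zero (x : Matrix m m k) :
    (DirectSum.decompose 𝒜 x 0 : Matrix m m k).trace = x.trace := by
  classical
  conv_rhs => rw [← DirectSum.sum_support_decompose 𝒜 x, trace_sum]
  rw [Finset.sum_eq_single 0]
  · exact fun g _ hg => trace_eq_zero_of_mem 𝒜 hg (SetLike.coe_mem _)
  · intro h
    rw [DFinsupp.notMem_support_iff.mp h]
    simp

/-- By nondegeneracy of the trace form, it suffices that each component of `x` of degree `l ≠ g`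
pairs to zero with all homogeneous elements. -/
theorem mem_of_trace_mul_eq_zero {g : G} {x : Matrix m m k}
    (hx : ∀ h : G, h ≠ -g → ∀ y ∈ 𝒜 h, (x * y).trace = 0) : x ∈ 𝒜 g := by
  have hcomp (l : G) (hl : l ≠ g) : (DirectSum.decompose 𝒜 x l : Matrix m m k) = 0 := by
    refine ext_iff_trace_mul_right.mpr fun y => ?_
    have h1 (h : G) (z : Matrix m m k) (hz : z ∈ 𝒜 h) :
        ((DirectSum.decompose 𝒜 x l : Matrix m m k) * z).trace = 0 := by
      by_cases hlh : l + h = 0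
      -- For `z` of degree `-l`, `x_l z` is the degree `0` part of `x z`, so it has the same trace.
      · rw [← DirectSum.coe_decompose_mul_add_of_right_mem 𝒜 hz, hlh, trace_decompose_zero]
        refine hx h (fun hg => hl ?_) z hz
        rw [hg] at hlh
        exact add_neg_eq_zero.mp hlh
      · exact trace_eq_zero_of_mem 𝒜 hlh (SetLike.mul_mem_graded (SetLike.coe_mem _) hz)
    classical
    rw [zero_mul, trace_zero, ← DirectSum.sum_support_decompose 𝒜 y, Finset.mul_sum, trace_sum]
    exact Finset.sum_eq_zero fun h _ => h1 h _ (SetLike.coe_mem _)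
  have hsupp : x = DirectSum.decompose 𝒜 x g := by
    classical
    conv_lhs => rw [← DirectSum.sum_support_decompose 𝒜 x]
    rw [Finset.sum_eq_single g]
    · exact fun l _ hl => hcomp l hl
    · intro h
      rw [DFinsupp.notMem_support_iff.mp h]
      simp
  rw [hsupp]
  exact SetLike.coe_mem _

end Graded

/-- The isomorphism `x ↦ (y ↦ tr (x y))` from a matrix algebra onto its dual. -/
noncomputable def traceDualEquiv (m k : Type*) [Fintype m] [DecidableEq m] [Field k] :
    Matrix m m k ≃ₗ[k] Module.Dual k (Matrix m m k) :=
  LinearEquiv.ofInjectiveOfFinrankEq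
    ((LinearMap.mul k (Matrix m m k)).compr₂ (traceLinearMap m k k))
    (fun _ _ h => ext_iff_trace_mul_right.mpr fun z => LinearMap.congr_fun h z)
    Subspace.dual_finrank_eq.symm

theorem traceDualEquiv_apply {m k : Type*} [Fintype m] [DecidableEq m] [Field k]
    (x y : Matrix m m k) : traceDualEquiv m k x y = (x * y).trace := rfl

end GradedSymm

theorem mainTheorem8 {k : Type*} [Field k] [IsAlgClosed k]
    {G : Type*} [AddCommGroup G] [DecidableEq G] (n : ℕ)
    (𝒜 : G → Submodule k (Matrix (Fin n) (Fin n) k)) [GradedAlgebra 𝒜] :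
    GradedSymm.IsGradedSymmetric 𝒜 := by
  refine ⟨inferInstance, GradedSymm.traceDualEquiv (Fin n) k, fun a x => ?_, fun x a => ?_,
    fun g => ?_⟩
  · ext1 y
    rw [GradedSymm.dualLeft_apply, GradedSymm.traceDualEquiv_apply,
      GradedSymm.traceDualEquiv_apply, mul_assoc, Matrix.trace_mul_comm, mul_assoc]
  · ext1 y
    rw [GradedSymm.dualRight_apply, GradedSymm.traceDualEquiv_apply,
      GradedSymm.traceDualEquiv_apply, mul_assoc]
  · ext f
    constructor
    · rintro ⟨x, hx, rfl⟩ h hh y hy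
      exact GradedSymm.trace_eq_zero_of_mem 𝒜 (fun h0 => hh (eq_neg_of_add_eq_zero_right h0))
        (SetLike.mul_mem_graded hx hy)
    · intro hf
      obtain ⟨x, rfl⟩ := (GradedSymm.traceDualEquiv (Fin n) k).surjective f
      exact ⟨x, GradedSymm.mem_of_trace_mul_eq_zero 𝒜 hf, rfl⟩
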